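/- Let $G$ be a finite group. A normal subgroup $N$ of $G$ is called quasi-minimal normal if it is minimal, among normal subgroups of $G$, subject to $1<N=[N,G]$. For such an $N$ let $Z_N$ denote the (uniquely determined) normal subgroup of $G$ that is maximal subject to $Z_N<N$. Write $[x,y]=x^{-1}y^{-1}xy$, write $N'=[N,N]$ for the derived subgroup of $N$, and let $\mathrm{d}(H)$ denote the minimal number of generators of a finite group $H$. Let $N$ be a soluble quasi-minimal normal subgroup of $G$ with $[Z_N,G]=1$, and let $C$ be a normal subgroup of $G$ with $[C,N]=1$. Let $m\ge 0$ and let $y(i)_j\in G$ ($i=1,2,3$, $1\le j\le m$) be elements such that $$G=C\langle y(i)_1,\dots,y(i)_m\rangle\qquad (i=1,2,3).$$ For $i=1,2,3$ define $\phi(i):N^{m}\to N$ by $$\phi(i)(b_1,\dots,b_m)=[b_1,y(i)_1]\,[b_2,y(i)_2]\cdots[b_m,y(i)_m].$$ Then for each $c\in N'$ there exist $c_1,c_2,c_3\in N$ such that $c=c_1c_2c_3$ and $$\left|\phi(i)^{-1}(c_i)\right|\ \ge\ |N|^{m}\cdot|N/Z_N|^{-r-2}\qquad(i=1,2,3),$$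 where $r=\mathrm{d}(G/C)$. -/

import Mathlib

/-- `N` is a quasi-minimal normal subgroup of `G`: it is minimal, among the normal subgroups `M`
of `G`, subject to `1 < M = [M, G]`. -/
def IsQuasiMinimalNormal {G : Type*} [Group G] (N : Subgroup G) : Prop :=
  Minimal (fun M : Subgroup G => M.Normal ∧ ⊥ < M ∧ M = ⁅M, (⊤ : Subgroup G)⁆) N

/-- `Z` is maximal among the normal subgroups of `G` that are properly contained in `N`. For a
quasi-minimal normal subgroup `N` of a finite group there is exactly one such `Z`, namely `Z_N`. -/
def IsMaximalNormalBelow {G : Type*} [Group G] (N Z : Subgroup G) : Prop :=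
  Maximal (fun M : Subgroup G => M.Normal ∧ M < N) Z

/-- The commutator in the convention `[x, y] = x⁻¹ y⁻¹ x y`. -/
def rightComm {G : Type*} [Group G] (x y : G) : G := x⁻¹ * y⁻¹ * x * y

theorem rightComm_mem {G : Type*} [Group G] (N : Subgroup G) [hN : N.Normal] (b : N) (y : G) :
    rightComm (b : G) y ∈ N := by
  have h : y⁻¹ * (b : G) * y ∈ N := by
    simpa using hN.conj_mem (b : G) b.2 y⁻¹
  have h2 := N.mul_mem (N.inv_mem b.2) h
  simpa [rightComm, mul_assoc] using h2

/-- The map `φ : N^m → N`, `(b_1, …, b_m) ↦ [b_1, y_1] [b_2, y_2] ⋯ [b_m, y_m]`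
(product taken in this order). -/
def commProdMap {G : Type*} [Group G] (N : Subgroup G) [N.Normal] {m : ℕ} (y : Fin m → G)
    (b : Fin m → N) : N :=
  (List.ofFn fun j : Fin m => (⟨rightComm (b j : G) (y j), rightComm_mem N (b j) (y j)⟩ : N)).prod

/-! Write `Z` for `Z_N`, `v = |N/Z|`, `w = |N'|`, `x = |N/N'|`. Solubility puts `N'` inside `Z`,
which is central, so commutation is an alternating `G`-invariant pairing on `N/Z` with values in
`N'`. As `N/Z` is `G`-irreducible, composing it with any nontrivial character of `N'` gives a
nondegenerate form (`mem_of_forall_char_derivedComm`), and this forces `w² ≤ v`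
(`card_sq_le_of_invariant_pairing`).

Each `φ(i)` is quadratic: it is multiplicative up to a biadditive correction in `N'`, and the
radical of the correction is the same for every nontrivial character. So is `Φ(u₀,u₁,u₂) = φ(1)(u₀)
φ(2)(u₁) φ(3)(u₂)`. Modulo `N'`, `Φ` is a surjective homomorphism, and its kernel `K` carries a
quadratic map to `N'`. Passing to `K` may enlarge the radical, but three independent variables
compensate (`QuadMap.card_charRad_mul_le`): in `K` the radical has index at least `v`. Gauss sums
then bound the fibre of `Φ` over `c` from below (`QuadMap.card_fiber_ge`).

Solutions having some coordinate in a small fibre are few, so one survives with all three fibres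
large (`exists_large_fibers`). The exponent `r` enters through `x ≤ v^r` (`card_abelianization_le`);
the extra `2` absorbs the remaining losses (`pigeonhole_bound`). -/

/-! ### Invariant alternating pairings on irreducible modules. -/

section Pairing

variable {V W : Type*} [AddCommGroup V] [AddCommGroup W]

/-- The character of `V` obtained by fixing the first argument of a bilinear map and composing
with a character of the target. -/
noncomputable def pairingChar (ω : V →+ V →+ W) (χ : AddChar W ℂ) (v : V) : AddChar V ℂ :=
  χ.compAddMonoidHom (ω v)

theorem pairingChar_apply (ω : V →+ V →+ W) (χ : AddChar W ℂ) (v u : V) :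
    pairingChar ω χ v u = χ (ω v u) := rfl

theorem pairingChar_bijective [Finite V] [Finite W] (ω : V →+ V →+ W) (χ : AddChar W ℂ)
    (hnd : ∀ v, (∀ u, χ (ω v u) = 1) → v = 0) : Function.Bijective (pairingChar ω χ) := by
  classical
  have := Fintype.ofFinite V
  rw [Fintype.bijective_iff_injective_and_card]
  refine ⟨fun v w h => ?_, AddChar.card_eq.symm⟩
  rw [← sub_eq_zero]
  refine hnd _ fun u => ?_
  have h' : χ (ω v u) = χ (ω w u) := DFunLike.congr_fun h u
  have hne : χ (ω w u) ≠ 0 := by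
    intro h0
    have := AddChar.norm_apply χ (ω w u)
    simp [h0] at this
  rw [map_sub, AddMonoidHom.sub_apply, AddChar.map_sub_eq_div, h', div_self hne]

/-- For an alternating nondegenerate pairing, the adjoint of `χ ∘ ω` with respect to `χ₀ ∘ ω`. -/
theorem exists_transfer [Finite V] [Finite W] (ω : V →+ V →+ W) (χ₀ χ : AddChar W ℂ)
    (hnd : ∀ v, (∀ u, χ₀ (ω v u) = 1) → v = 0) :
    ∃ e : AddMonoid.End V, ∀ v u, χ₀ (ω (e v) u) = χ (ω v u) := by
  have hbij := pairingChar_bijective ω χ₀ hnd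
  choose f hf using fun v => hbij.2 (pairingChar ω χ v)
  have hf' : ∀ v u, χ₀ (ω (f v) u) = χ (ω v u) := fun v u => DFunLike.congr_fun (hf v) u
  refine ⟨AddMonoidHom.mk' f fun a b => hbij.1 ?_, hf'⟩
  ext u
  simp only [pairingChar_apply, map_add, AddMonoidHom.add_apply, AddChar.map_add_eq_mul, hf']

theorem alternating_swap (ω : V →+ V →+ W) (halt : ∀ v, ω v v = 0) (u v : V) :
    ω u v = -ω v u := by
  have h := halt (u + v)
  simp only [map_add, AddMonoidHom.add_apply, halt, zero_add, add_zero] at h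
  exact eq_neg_of_add_eq_zero_right h

/-- If `V` carries an irreducible action preserving an alternating `W`-valued pairing all of whose
nontrivial scalar specialisations are nondegenerate, then `|W|² ≤ |V|`. -/
theorem card_sq_le_of_invariant_pairing [Finite V] [Finite W] [Nontrivial V] (S : Set (AddMonoid.End V))
    (hS : ∀ L : AddSubgroup V, (∀ s ∈ S, ∀ v ∈ L, s v ∈ L) → L = ⊥ ∨ L = ⊤)
    (ω : V →+ V →+ W) (halt : ∀ v, ω v v = 0)
    (hinv : ∀ s ∈ S, ∀ u v, ω (s u) (s v) = ω u v)
    (hnd : ∀ χ : AddChar W ℂ, χ ≠ 0 → ∀ v, (∀ u, χ (ω v u) = 1) → v = 0) :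
    Nat.card W ^ 2 ≤ Nat.card V := by
  classical
  obtain hW | hW := subsingleton_or_nontrivial W
  · rw [Nat.card_of_subsingleton (0 : W), one_pow]
    exact Nat.card_pos
  obtain ⟨w₀, hw₀⟩ := exists_ne (0 : W)
  obtain ⟨χ₀, hχ₀⟩ := AddChar.exists_apply_ne_zero.2 hw₀
  have hχ₀ : χ₀ ≠ 0 := by rintro rfl; exact hχ₀ rfl
  have hnd₀ := hnd χ₀ hχ₀
  have hbij := pairingChar_bijective ω χ₀ hnd₀
  have hext : ∀ v w, (∀ u, χ₀ (ω v u) = χ₀ (ω w u)) → v = w :=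
    fun v w h => hbij.1 (by ext u; exact h u)
  have hsurj : ∀ s ∈ S, Function.Surjective s := by
    intro s hs
    refine Finite.surjective_of_injective ?_
    rw [injective_iff_map_eq_zero]
    intro a ha
    refine hnd₀ a fun u => ?_
    rw [← hinv s hs, ha]
    simp
  choose e he using fun χ => exists_transfer ω χ₀ χ hnd₀
  have hmul : ∀ (a b : AddMonoid.End V) v, (a * b) v = a (b v) := fun _ _ _ => rfl
  have hsimple : ∀ f : V →+ V, (∀ s ∈ S, ∀ v, s (f v) = f (s v)) →
      (∀ v, f v = 0) ∨ ∀ v, f v = 0 → v = 0 := by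
    intro f hf
    have := hS f.ker (by
      intro s hs v hv
      rw [AddMonoidHom.mem_ker] at hv ⊢
      rw [← hf s hs, hv, map_zero])
    obtain h | h := this
    · refine Or.inr fun v hv => ?_
      have : v ∈ f.ker := hv
      rwa [h, AddSubgroup.mem_bot] at this
    · refine Or.inl fun v => ?_
      have : v ∈ f.ker := by rw [h]; trivial
      exact this
  -- Schur's lemma makes nonzero elements of `E` injective, so `E` is a finite domain and hence
  -- commutative by Wedderburn. It contains every `e χ`.
  set E := Subring.centralizer S with hE
  have hmem : ∀ χ, e χ ∈ E := by
    intro χ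
    rw [hE, Subring.mem_centralizer_iff]
    intro s hs
    ext v
    refine hext _ _ fun u => ?_
    obtain ⟨u, rfl⟩ := hsurj s hs u
    simp only [hmul]
    rw [hinv s hs, he, he, hinv s hs]
  have hcommS : ∀ f ∈ E, ∀ s ∈ S, ∀ v, s (f v) = f (s v) := fun f hf s hs v =>
    DFunLike.congr_fun (Subring.mem_centralizer_iff.1 hf s hs) v
  have hker : ∀ f ∈ E, f ≠ 0 → ∀ v, f v = 0 → v = 0 := by
    intro f hf hf0 v hv
    obtain h | h := hsimple f (hcommS f hf)
    · exact absurd (AddMonoidHom.ext h) hf0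
    · exact h v hv
  have : Finite (AddMonoid.End V) := Finite.of_injective (fun f => (f : V → V)) DFunLike.coe_injective
  have : Nontrivial E := ⟨0, 1, by
    intro h
    obtain ⟨v, hv⟩ := exists_ne (0 : V)
    exact hv (DFunLike.congr_fun (congrArg Subtype.val h) v).symm⟩
  have : NoZeroDivisors E := ⟨by
    intro a b hab
    by_contra! hc
    obtain ⟨v, hv⟩ := exists_ne (0 : V)
    have h1 : (b : AddMonoid.End V) ≠ 0 := fun h => hc.2 (Subtype.ext h)
    have h2 : (a : AddMonoid.End V) ≠ 0 := fun h => hc.1 (Subtype.ext h)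
    exact hv (hker b b.2 h1 v (hker a a.2 h2 _ (DFunLike.congr_fun (congrArg Subtype.val hab) v)))⟩
  have : IsDomain E := NoZeroDivisors.to_isDomain E
  have hcomm : ∀ a ∈ E, ∀ b ∈ E, ∀ v, a (b v) = b (a v) := by
    intro a ha b hb v
    have := (Finite.isDomain_to_isField E).mul_comm ⟨a, ha⟩ ⟨b, hb⟩
    exact DFunLike.congr_fun (congrArg Subtype.val this) v
  have hself : ∀ χ x y, χ₀ (ω (e χ x) y) = χ₀ (ω x (e χ y)) := by
    intro χ x y
    rw [he, alternating_swap ω halt x y, alternating_swap ω halt x (e χ y),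
      AddChar.map_neg_eq_conj, AddChar.map_neg_eq_conj, he]
  obtain ⟨u, hu⟩ := exists_ne (0 : V)
  -- Self-adjointness, commutativity and alternation give only that the square of this value is `1`.
  -- If `2` is injective on `V`, write `u = 2x`; otherwise `2V = 0` by irreducibility.
  have hiso : ∀ χ χ', χ₀ (ω (e χ' u) (e χ u)) = 1 := by
    intro χ χ'
    have hsq : ∀ x, χ₀ (ω (e χ' x) (e χ x)) ^ 2 = 1 := by
      intro x
      have h1 : χ₀ (ω (e χ' x) (e χ x)) = χ₀ (ω (e χ x) (e χ' x)) := by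
        rw [hself, hcomm _ (hmem χ') _ (hmem χ), ← hself]
      rw [sq]
      nth_rewrite 1 [h1]
      rw [← AddChar.map_add_eq_mul, alternating_swap ω halt (e χ x), neg_add_cancel,
        AddChar.map_zero_eq_one]
    obtain htwo | h2 := hsimple (nsmulAddMonoidHom 2) (fun s hs v => map_nsmul s 2 v)
    swap
    · obtain ⟨x, rfl⟩ := Finite.surjective_of_injective
        ((injective_iff_map_eq_zero (nsmulAddMonoidHom 2 : V →+ V)).2 h2) u
      simp only [nsmulAddMonoidHom_apply, map_nsmul, AddMonoidHom.nsmul_apply,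
        AddChar.map_nsmul_eq_pow]
      rw [hsq, one_pow]
    · replace htwo : ∀ v : V, v + v = 0 := fun v => by
        rw [← two_nsmul]; exact htwo v
      -- In characteristic 2, squaring is injective on the finite set of self-adjoint elements of
      -- `E`, because `(a - b)² = a² - b²`. So `e χ' * e χ` is some `h²`, and the value becomes `χ₀
      -- (ω (h u) (h u)) = 1`.
      let F := {h : AddMonoid.End V // h ∈ E ∧ ∀ x y, χ₀ (ω (h x) y) = χ₀ (ω x (h y))}
      have hFinj : Function.Injective (fun h : F => (⟨h.1 * h.1, mul_mem h.2.1 h.2.1, by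
          intro x y
          simp only [hmul]
          rw [h.2.2, h.2.2]⟩ : F)) := by
        rintro ⟨a, ha, _⟩ ⟨b, hb, _⟩ hab
        have hab : ∀ v, a (a v) = b (b v) :=
          fun v => DFunLike.congr_fun (congrArg Subtype.val hab) v
        refine Subtype.ext ?_
        by_contra hne
        obtain ⟨v, hv⟩ := exists_ne (0 : V)
        have hk := hker (a - b) (sub_mem ha hb) (sub_ne_zero.2 hne)
        refine hv (hk _ (hk _ ?_))
        have hsub : ∀ x, (a - b) x = a x - b x := fun _ => rfl
        rw [hsub, hsub, map_sub, map_sub, hab, hcomm b hb a ha]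
        calc b (b v) - a (b v) - (a (b v) - b (b v))
            = (b (b v) + b (b v)) - (a (b v) + a (b v)) := by abel
          _ = 0 := by rw [htwo, htwo, sub_zero]
      obtain ⟨⟨h, hhE, hh⟩, hhef⟩ := (Finite.surjective_of_injective hFinj)
        ⟨e χ' * e χ, mul_mem (hmem _) (hmem _), by
          intro x y
          simp only [hmul]
          rw [hself, hself, hcomm _ (hmem χ') _ (hmem χ)]⟩
      have hh2 : ∀ v, h (h v) = e χ' (e χ v) :=
        fun v => DFunLike.congr_fun (congrArg Subtype.val hhef) v
      rw [hself, ← hh2, ← hh, halt, AddChar.map_zero_eq_one]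
  -- A nontrivial character of `W` killing the range of `ω u` would put `u ≠ 0` in its radical.
  have hrange : Function.Surjective (ω u) := by
    rw [← AddMonoidHom.range_eq_top]
    by_contra hne
    obtain ⟨x, hx⟩ : ∃ x, x ∉ (ω u).range := by
      by_contra! h
      exact hne (eq_top_iff.2 fun x _ => h x)
    obtain ⟨ψ, hψ⟩ := AddChar.exists_apply_ne_zero.2
      (show (QuotientAddGroup.mk x : W ⧸ (ω u).range) ≠ 0 from
        fun h => hx ((QuotientAddGroup.eq_zero_iff x).1 h))
    refine hu (hnd (ψ.compAddMonoidHom (QuotientAddGroup.mk' _)) ?_ u fun v => ?_)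
    · intro h
      exact hψ (DFunLike.congr_fun h x)
    · have : (QuotientAddGroup.mk (ω u v) : W ⧸ (ω u).range) = 0 :=
        (QuotientAddGroup.eq_zero_iff _).2 ⟨v, rfl⟩
      simp [this]
  -- The dual of `W` embeds in the kernel of `ω u`, whose index is `|W|`; this yields both factors
  -- of `|W|²`.
  have hinj : Function.Injective (fun χ => (⟨e χ u, by
      rw [AddMonoidHom.mem_ker]
      by_contra hne
      obtain ⟨χ', hχ'⟩ := AddChar.exists_apply_ne_zero.2 hne
      exact hχ' (by rw [← he, hiso])⟩ : (ω u).ker)) := by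
    intro χ χ' h
    ext x
    obtain ⟨v, rfl⟩ := hrange x
    have h : e χ u = e χ' u := congrArg Subtype.val h
    rw [← he χ, ← he χ', h]
  have hle := Nat.card_le_card_of_injective _ hinj
  have hcW : Nat.card (AddChar W ℂ) = Nat.card W := by
    have := Fintype.ofFinite W
    rw [Nat.card_eq_fintype_card, Nat.card_eq_fintype_card, AddChar.card_eq]
  have hq : (ω u).ker.index = Nat.card W := by
    rw [AddSubgroup.index_ker, AddMonoidHom.range_eq_top.2 hrange, Nat.card_congr AddSubgroup.topEquiv.toEquiv]
  rw [sq, ← (ω u).ker.card_mul_index, hq]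
  exact Nat.mul_le_mul_right _ (hcW ▸ hle)

end Pairing

/-! ### Gauss sums for quadratic maps. -/

section Fourier

open Finset

/-- Gauss sum estimate for a map from a finite group whose deviation from additivity is additive in
the second variable. -/
theorem norm_sq_charSum_le {K W : Type*} [Group K] [Fintype K] [AddCommGroup W] [Finite W]
    (Q : K → W) (B : K → Additive K →+ W)
    (hQ : ∀ a b, Q (a * b) = Q a + Q b + B a (Additive.ofMul b)) (χ : AddChar W ℂ) :
    ‖∑ a, χ (Q a)‖ ^ 2 ≤
      (Nat.card {a : K // ∀ b, χ (B a (Additive.ofMul b)) = 1} : ℝ) * Nat.card K := by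
  classical
  have hne : ∀ w, χ w * (starRingEnd ℂ) (χ w) = 1 := by
    intro w
    rw [Complex.mul_conj, Complex.normSq_eq_norm_sq, AddChar.norm_apply]
    simp
  -- Substituting `a * b` for the first summation variable leaves `χ (Q a) χ (B a b)`. The inner sum
  -- over `b` is a character sum, nonzero only when `a` lies in the radical.
  have key : (∑ a, χ (Q a)) * (starRingEnd ℂ) (∑ a, χ (Q a)) =
      ∑ a, χ (Q a) * ∑ b : Additive K, (χ.compAddMonoidHom (B a)) b := by
    rw [map_sum, Finset.sum_mul_sum, Finset.sum_comm]
    simp only [Finset.mul_sum]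
    rw [Finset.sum_comm (s := univ) (t := (univ : Finset (Additive K)))]
    refine Fintype.sum_equiv Additive.ofMul _ _ fun b => ?_
    refine (Fintype.sum_equiv (Equiv.mulRight b) _ _ fun a => ?_).symm
    simp only [Equiv.coe_mulRight, hQ, AddChar.map_add_eq_mul]
    rw [mul_right_comm, mul_assoc (χ (Q a)), hne, mul_one]
    rfl
  have h1 : ‖∑ a, χ (Q a)‖ ^ 2 = ‖(∑ a, χ (Q a)) * (starRingEnd ℂ) (∑ a, χ (Q a))‖ := by
    rw [norm_mul, RCLike.norm_conj, sq]
  rw [h1, key]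
  refine (norm_sum_le _ _).trans ?_
  have h2 : ∀ a, ‖χ (Q a) * ∑ b : Additive K, (χ.compAddMonoidHom (B a)) b‖ =
      if (∀ b, χ (B a (Additive.ofMul b)) = 1) then (Nat.card K : ℝ) else 0 := by
    intro a
    rw [norm_mul, AddChar.norm_apply, one_mul, AddChar.sum_eq_ite]
    have : χ.compAddMonoidHom (B a) = 0 ↔ ∀ b, χ (B a (Additive.ofMul b)) = 1 := by
      rw [AddChar.eq_zero_iff]
      exact Iff.rfl
    simp only [this]
    split_ifs <;> simp
  simp only [h2]
  rw [← Finset.sum_filter, Finset.sum_const, nsmul_eq_mul, Nat.card_eq_fintype_card (α := {a // _}),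
    Fintype.card_subtype]

/-- Lower bound for the number of representations by a quadratic map all of whose nontrivial
character specialisations have small radical. -/
theorem card_fiber_ge_of_radical_le {K W : Type*} [Group K] [Finite K] [AddCommGroup W] [Finite W]
    (Q : K → W) (B : K → Additive K →+ W)
    (hQ : ∀ a b, Q (a * b) = Q a + Q b + B a (Additive.ofMul b)) (v : ℕ) (hv : 0 < v)
    (hrad : ∀ χ : AddChar W ℂ, χ ≠ 0 →
      Nat.card {a : K // ∀ b, χ (B a (Additive.ofMul b)) = 1} * v ≤ Nat.card K) (c : W) :
    (Nat.card K : ℝ) * (√v - (Nat.card W - 1)) ≤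
      (Nat.card {a : K // Q a = c} : ℝ) * Nat.card W * √v := by
  classical
  have := Fintype.ofFinite K
  have := Fintype.ofFinite W
  have hv' : (0 : ℝ) < √v := Real.sqrt_pos.2 (by exact_mod_cast hv)
  have hS : ∀ χ : AddChar W ℂ, χ ≠ 0 → ‖∑ a, χ (Q a)‖ * √v ≤ Nat.card K := by
    intro χ hχ
    refine abs_le_of_sq_le_sq' ?_ (by positivity) |>.2
    rw [mul_pow, Real.sq_sqrt (by positivity)]
    calc ‖∑ a, χ (Q a)‖ ^ 2 * v
        ≤ (Nat.card {a : K // ∀ b, χ (B a (Additive.ofMul b)) = 1} : ℝ) * Nat.card K * v := by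
          gcongr
          exact norm_sq_charSum_le Q B hQ χ
      _ = ((Nat.card {a : K // ∀ b, χ (B a (Additive.ofMul b)) = 1} * v : ℕ) : ℝ) * Nat.card K := by
          push_cast; ring
      _ ≤ (Nat.card K : ℝ) * Nat.card K := by
          gcongr
          exact hrad χ hχ
      _ = (Nat.card K : ℝ) ^ 2 := (sq _).symm
  -- Orthogonality of characters. The trivial character contributes `|K|`, and each of the `|W| - 1`
  -- others at most `|K| / √v`.
  have hT : ((Nat.card {a : K // Q a = c} : ℝ) * Nat.card W : ℂ) =
      ∑ χ : AddChar W ℂ, χ (-c) * ∑ a, χ (Q a) := by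
    simp only [Finset.mul_sum]
    rw [Finset.sum_comm]
    simp only [← AddChar.map_add_eq_mul, AddChar.sum_apply_eq_ite]
    rw [← Finset.sum_filter, Finset.sum_const, nsmul_eq_mul,
      Nat.card_eq_fintype_card (α := {a // _}), Fintype.card_subtype, Nat.card_eq_fintype_card]
    congr 3
    congr 1
    ext a
    simp only [mem_filter, mem_univ, true_and]
    rw [neg_add_eq_zero, eq_comm]
  rw [← Finset.add_sum_erase _ _ (mem_univ (0 : AddChar W ℂ))] at hT
  have h0 : (0 : AddChar W ℂ) (-c) * ∑ a, (0 : AddChar W ℂ) (Q a) = (Nat.card K : ℂ) := by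
    simp
  rw [h0] at hT
  have herr : ‖∑ χ ∈ univ.erase (0 : AddChar W ℂ), χ (-c) * ∑ a, χ (Q a)‖ * √v ≤
      (Nat.card W - 1) * Nat.card K := by
    calc _ ≤ (∑ χ ∈ univ.erase (0 : AddChar W ℂ), ‖χ (-c) * ∑ a, χ (Q a)‖) * √v := by
          gcongr; exact norm_sum_le _ _
      _ = ∑ χ ∈ univ.erase (0 : AddChar W ℂ), ‖∑ a, χ (Q a)‖ * √v := by
          rw [Finset.sum_mul]
          simp only [norm_mul, AddChar.norm_apply, one_mul]
      _ ≤ ∑ χ ∈ univ.erase (0 : AddChar W ℂ), (Nat.card K : ℝ) :=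
          Finset.sum_le_sum fun χ hχ => hS χ (Finset.ne_of_mem_erase hχ)
      _ = _ := by
          rw [Finset.sum_const, Finset.card_erase_of_mem (mem_univ _), Finset.card_univ,
            AddChar.card_eq, nsmul_eq_mul, Nat.cast_sub Fintype.card_pos, Nat.card_eq_fintype_card]
          simp
  have hre : (Nat.card K : ℝ) - ‖∑ χ ∈ univ.erase (0 : AddChar W ℂ), χ (-c) * ∑ a, χ (Q a)‖ ≤
      (Nat.card {a : K // Q a = c} : ℝ) * Nat.card W := by
    have h := congrArg Complex.re hT
    have h' : (((Nat.card {a : K // Q a = c} : ℝ) * Nat.card W : ℂ)).re =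
        (Nat.card {a : K // Q a = c} : ℝ) * Nat.card W := by
      norm_cast
    rw [h', Complex.add_re, Complex.natCast_re] at h
    rw [h]
    have := Complex.abs_re_le_norm (∑ χ ∈ univ.erase (0 : AddChar W ℂ), χ (-c) * ∑ a, χ (Q a))
    linarith [(abs_le.1 this).1]
  nlinarith [mul_le_mul_of_nonneg_right hre hv'.le]

end Fourier

/-! ### Quadratic maps into a group with central derived subgroup. -/

section QuadraticMaps

theorem exists_addChar_of_ker_le {U A M : Type*} [Group U] [CommGroup A] [CommMonoid M]
    (π : U →* A) (hπ : Function.Surjective π) (f : U →* M) (h : π.ker ≤ f.ker) :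
    ∃ ψ : AddChar (Additive A) M, ∀ u, ψ (Additive.ofMul (π u)) = f u := by
  have key : ∀ u u', π u = π u' → f u = f u' := by
    intro u u' huu
    have : u'⁻¹ * u ∈ f.ker := h (by
      rw [MonoidHom.mem_ker, map_mul, map_inv, huu, inv_mul_cancel])
    rw [← mul_inv_cancel_left u' u, map_mul, MonoidHom.mem_ker.1 this, mul_one]
  have hs := Function.surjInv_eq hπ
  refine ⟨⟨fun a => f (Function.surjInv hπ a.toMul), ?_, fun a b => ?_⟩, fun u => ?_⟩
  · rw [← map_one f]
    exact key _ _ (by rw [hs, map_one]; rfl)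
  · rw [← map_mul]
    exact key _ _ (by rw [hs, map_mul, hs, hs]; rfl)
  · exact key _ _ (hs _)

open scoped IsMulCommutative

variable {N : Type*} [Group N]

/-- The commutator `a⁻¹ b⁻¹ a b` as an element of the derived subgroup. -/
def derivedComm (a b : N) : commutator N :=
  ⟨a⁻¹ * b⁻¹ * a * b, by
    have := Subgroup.commutator_mem_commutator (Subgroup.mem_top a⁻¹) (Subgroup.mem_top b⁻¹)
    rw [commutatorElement_def, inv_inv, inv_inv] at this
    exact this⟩

theorem coe_derivedComm (a b : N) : (derivedComm a b : N) = a⁻¹ * b⁻¹ * a * b := rfl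

theorem mul_eq_mul_derivedComm (a b : N) : a * b = b * a * derivedComm a b := by
  rw [coe_derivedComm]; group

theorem derivedComm_swap (a b : N) : derivedComm a b = (derivedComm b a)⁻¹ := by
  ext
  simp only [Subgroup.coe_inv, coe_derivedComm]
  group

theorem derivedComm_self (a : N) : derivedComm a a = 1 := by
  ext
  simp [coe_derivedComm]

theorem derivedComm_mul_left (hc : commutator N ≤ Subgroup.center N) (a b c : N) :
    derivedComm (a * b) c = derivedComm a c * derivedComm b c := by
  ext
  have h := Subgroup.mem_center_iff.1 (hc (derivedComm a c).2) b⁻¹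
  simp only [Subgroup.coe_mul, coe_derivedComm] at h ⊢
  calc (a * b)⁻¹ * c⁻¹ * (a * b) * c
      = (b⁻¹ * (a⁻¹ * c⁻¹ * a * c)) * (c⁻¹ * b * c) := by group
    _ = _ := by rw [h]; group

theorem derivedComm_mul_right (hc : commutator N ≤ Subgroup.center N) (a b c : N) :
    derivedComm a (b * c) = derivedComm a b * derivedComm a c := by
  ext
  have h := Subgroup.mem_center_iff.1 (hc (derivedComm a b).2) c
  have h' := Subgroup.mem_center_iff.1 (hc (derivedComm a b).2) (a⁻¹ * c⁻¹ * a * c)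
  simp only [Subgroup.coe_mul, coe_derivedComm] at h h' ⊢
  calc a⁻¹ * (b * c)⁻¹ * a * (b * c)
      = (a⁻¹ * c⁻¹ * a) * (a⁻¹ * b⁻¹ * a * b * c) := by group
    _ = (a⁻¹ * c⁻¹ * a * c) * (a⁻¹ * b⁻¹ * a * b) := by rw [← h]; group
    _ = _ := by rw [h']

theorem derivedComm_eq_one_of_central {z : N} (hz : z ∈ Subgroup.center N) (a : N) :
    derivedComm z a = 1 := by
  ext
  have := Subgroup.mem_center_iff.1 hz a
  rw [coe_derivedComm, mul_assoc, ← this]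
  simp

theorem derivedComm_eq_one_of_central_right {z : N} (hz : z ∈ Subgroup.center N) (a : N) :
    derivedComm a z = 1 := by
  rw [derivedComm_swap, derivedComm_eq_one_of_central hz, inv_one]

/-- A map from a group `U` to `N` that is multiplicative up to a biadditive correction with values
in the derived subgroup of `N`, together with a subgroup `rad` which controls the radicals of all
nontrivial scalar specialisations of the correction. -/
structure QuadMap [IsMulCommutative (commutator N)] (Z : Subgroup N) (U : Type*) [Group U] where
  toFun : U → N
  polar : U → U → commutator N
  rad : Subgroup U
  rad_normal : rad.Normal
  map_mul : ∀ a b, toFun (a * b) = toFun a * toFun b * polar a b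
  polar_mul_left : ∀ a b c, polar (a * b) c = polar a c * polar b c
  polar_mul_right : ∀ a b c, polar a (b * c) = polar a b * polar a c
  rad_mem : ∀ r ∈ rad, toFun r ∈ Z
  polar_rad : ∀ a, ∀ r ∈ rad, polar a r = 1
  nondeg : ∀ χ : AddChar (Additive (commutator N)) ℂ, χ ≠ 0 → ∀ a,
    (∀ b, χ (Additive.ofMul (polar a b)) = 1) → a ∈ rad

namespace QuadMap

variable [IsMulCommutative (commutator N)]

variable {Z : Subgroup N} {U U' : Type*} [Group U] [Group U']

theorem polar_one_right (q : QuadMap Z U) (a : U) : q.polar a 1 = 1 :=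
  q.polar_rad a 1 q.rad.one_mem

theorem polar_one_left (q : QuadMap Z U) (a : U) : q.polar 1 a = 1 := by
  have := q.polar_mul_left 1 1 a
  rw [one_mul] at this
  exact left_eq_mul.1 this

theorem map_one (q : QuadMap Z U) : q.toFun 1 = 1 := by
  have := q.map_mul 1 1
  rw [polar_one_right, mul_one, Subgroup.coe_one, mul_one] at this
  exact left_eq_mul.1 this

/-- Transport along an isomorphism of the source. -/
def comap (q : QuadMap Z U) (e : U' ≃* U) : QuadMap Z U' where
  toFun u := q.toFun (e u)
  polar a b := q.polar (e a) (e b)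
  rad := q.rad.comap e.toMonoidHom
  rad_normal := q.rad_normal.comap _
  map_mul a b := by rw [_root_.map_mul, q.map_mul]
  polar_mul_left a b c := by rw [_root_.map_mul, q.polar_mul_left]
  polar_mul_right a b c := by rw [_root_.map_mul, q.polar_mul_right]
  rad_mem r hr := q.rad_mem _ hr
  polar_rad a r hr := q.polar_rad _ _ hr
  nondeg χ hχ a h := q.nondeg χ hχ _ fun b => by
    obtain ⟨b, rfl⟩ := e.surjective b
    exact h b

/-- The trivial map. -/
def trivial (Z : Subgroup N) (U : Type*) [Group U] : QuadMap Z U where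
  toFun _ := 1
  polar _ _ := 1
  rad := ⊤
  rad_normal := inferInstance
  map_mul _ _ := by simp
  polar_mul_left _ _ _ := by simp
  polar_mul_right a b c := by simp
  rad_mem r _ := Z.one_mem
  polar_rad a r _ := rfl
  nondeg _ _ _ _ := Subgroup.mem_top _

/-- The pointwise product of two quadratic maps in independent variables. -/
def prod (hc : commutator N ≤ Subgroup.center N) (hZ : Z ≤ Subgroup.center N)
    (q : QuadMap Z U) (q' : QuadMap Z U') : QuadMap Z (U × U') where
  toFun u := q.toFun u.1 * q'.toFun u.2
  polar a b := q.polar a.1 b.1 * q'.polar a.2 b.2 * derivedComm (q.toFun b.1) (q'.toFun a.2)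
  rad := q.rad.prod q'.rad
  rad_normal := by
    have := q.rad_normal
    have := q'.rad_normal
    infer_instance
  map_mul a b := by
    have h1 := fun x => Subgroup.mem_center_iff.1 (hc (q.polar a.1 b.1).2) x
    have h2 := fun x => Subgroup.mem_center_iff.1
      (hc (derivedComm (q.toFun b.1) (q'.toFun a.2)).2) x
    rw [Prod.fst_mul, Prod.snd_mul, q.map_mul, q'.map_mul]
    simp only [Subgroup.coe_mul]
    calc q.toFun a.1 * q.toFun b.1 * (q.polar a.1 b.1) *
          (q'.toFun a.2 * q'.toFun b.2 * (q'.polar a.2 b.2))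
        = q.toFun a.1 * (q.toFun b.1 * q'.toFun a.2) * q'.toFun b.2 * (q.polar a.1 b.1) *
            (q'.polar a.2 b.2) := by
          simp only [mul_assoc]
          rw [← mul_assoc _ (q'.toFun a.2), ← h1]
          simp only [mul_assoc]
          rw [← mul_assoc _ (q'.toFun b.2), ← h1]
          simp only [mul_assoc]
      _ = _ := by
          rw [mul_eq_mul_derivedComm (q.toFun b.1)]
          simp only [mul_assoc]
          rw [← h2]
          simp only [mul_assoc]
  polar_mul_left a b c := by
    simp only [Prod.fst_mul, Prod.snd_mul]
    rw [q.polar_mul_left, q'.polar_mul_left, q'.map_mul, derivedComm_mul_right hc,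
      derivedComm_mul_right hc, derivedComm_eq_one_of_central_right (hc (q'.polar _ _).2), mul_one]
    simp only [mul_assoc, mul_comm, mul_left_comm]
  polar_mul_right a b c := by
    simp only [Prod.fst_mul, Prod.snd_mul]
    rw [q.polar_mul_right, q'.polar_mul_right, q.map_mul, derivedComm_mul_left hc,
      derivedComm_mul_left hc, derivedComm_eq_one_of_central (hc (q.polar _ _).2), mul_one]
    simp only [mul_assoc, mul_comm, mul_left_comm]
  rad_mem r hr := Z.mul_mem (q.rad_mem _ hr.1) (q'.rad_mem _ hr.2)
  polar_rad a r hr := by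
    rw [q.polar_rad _ _ hr.1, q'.polar_rad _ _ hr.2,
      derivedComm_eq_one_of_central (hZ (q.rad_mem _ hr.1)), mul_one, mul_one]
  -- Testing against `(1, b)` removes the cross term and places `a.2` in `q'.rad`. Then `q'.toFun
  -- a.2` is central, so the cross term also vanishes against `(b, 1)`.
  nondeg χ hχ a h := by
    have h2 : a.2 ∈ q'.rad := q'.nondeg χ hχ _ fun b => by
      have := h (1, b)
      rwa [q.polar_one_right, q.map_one, one_mul,
        derivedComm_eq_one_of_central (Subgroup.one_mem _), mul_one] at this
    refine ⟨q.nondeg χ hχ _ fun b => ?_, h2⟩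
    have := h (b, 1)
    rwa [q'.polar_one_right, mul_one,
      derivedComm_eq_one_of_central_right (hZ (q'.rad_mem _ h2)), mul_one] at this

/-- The map `b ↦ b⁻¹ σ(b)` attached to an automorphism `σ` fixing `Z` pointwise. -/
def ofAut [Z.Normal] (hW : commutator N ≤ Z) (hZ : Z ≤ Subgroup.center N)
    (hnd : ∀ χ : AddChar (Additive (commutator N)) ℂ, χ ≠ 0 → ∀ a,
      (∀ b, χ (Additive.ofMul (derivedComm a b)) = 1) → a ∈ Z)
    (σ : N ≃* N) (hσ : ∀ z ∈ Z, σ z = z) : QuadMap Z N :=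
  have hc := hW.trans hZ
  have map_mul : ∀ a b, (a * b)⁻¹ * σ (a * b) =
      (a⁻¹ * σ a) * (b⁻¹ * σ b) * derivedComm (a⁻¹ * σ a) b := by
    intro a b
    have h := Subgroup.mem_center_iff.1 (hc (derivedComm (a⁻¹ * σ a) b).2) (b⁻¹ * σ b)
    rw [mul_assoc _ (b⁻¹ * σ b), h, coe_derivedComm, _root_.map_mul]
    group
  let f : N →* N ⧸ Z := MonoidHom.mk' (fun b => ((b⁻¹ * σ b : N) : N ⧸ Z)) fun a b => by
    rw [map_mul, ← QuotientGroup.mk_mul, QuotientGroup.mk_mul_of_mem]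
    exact hW (derivedComm _ _).2
  have mem_ker : ∀ b, b ∈ f.ker ↔ b⁻¹ * σ b ∈ Z := fun b => QuotientGroup.eq_one_iff _
  { toFun b := b⁻¹ * σ b
    polar a b := derivedComm (a⁻¹ * σ a) b
    rad := f.ker
    rad_normal := inferInstance
    map_mul := map_mul
    polar_mul_left a b c := by
      rw [map_mul, derivedComm_mul_left hc, derivedComm_mul_left hc,
        derivedComm_eq_one_of_central (hc (derivedComm _ _).2), mul_one]
    polar_mul_right a b c := derivedComm_mul_right hc _ _ _
    rad_mem r hr := (mem_ker r).1 hr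
    polar_rad a r hr := by
      -- `r` and `σ r` agree modulo `Z`, and `σ` fixes `N'` pointwise, so `[σ a, r] = [σ a, σ r] =
      -- [a, r]`.
      have h1 : derivedComm (σ a) r = derivedComm a r := by
        have hr' : σ r = r * (r⁻¹ * σ r) := by group
        have h2 : derivedComm (σ a) (σ r) = derivedComm a r := by
          ext
          rw [← hσ _ (hW (derivedComm a r).2)]
          simp only [coe_derivedComm, _root_.map_mul, map_inv]
        rw [← h2, hr', derivedComm_mul_right hc,
          derivedComm_eq_one_of_central_right (hZ ((mem_ker r).1 hr)), mul_one]
      rw [derivedComm_mul_left hc, h1, ← derivedComm_mul_left hc, inv_mul_cancel,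
        derivedComm_eq_one_of_central (Subgroup.one_mem _)]
    nondeg χ hχ a h := (mem_ker a).2 (hnd χ hχ _ h) }

/-- The quadratic map on `Nᵐ` sending `b` to `∏ bⱼ⁻¹ σⱼ(bⱼ)`. -/
def ofAutFamily [Z.Normal] (hW : commutator N ≤ Z) (hZ : Z ≤ Subgroup.center N)
    (hnd : ∀ χ : AddChar (Additive (commutator N)) ℂ, χ ≠ 0 → ∀ a,
      (∀ b, χ (Additive.ofMul (derivedComm a b)) = 1) → a ∈ Z) :
    ∀ (m : ℕ) (σ : Fin m → N ≃* N) (_ : ∀ i, ∀ z ∈ Z, σ i z = z), QuadMap Z (Fin m → N)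
  | 0, _, _ => trivial Z _
  | m + 1, σ, hσ =>
    ((ofAut hW hZ hnd (σ 0) (hσ 0)).prod (hW.trans hZ) hZ
      (ofAutFamily hW hZ hnd m (fun i => σ i.succ) fun i => hσ i.succ)).comap
      { toFun b := (b 0, fun i => b i.succ)
        invFun b := Fin.cons b.1 b.2
        left_inv b := Fin.cons_self_tail b
        right_inv _ := rfl
        map_mul' _ _ := rfl }

theorem ofAutFamily_toFun [Z.Normal] (hW : commutator N ≤ Z) (hZ : Z ≤ Subgroup.center N)
    (hnd : ∀ χ : AddChar (Additive (commutator N)) ℂ, χ ≠ 0 → ∀ a,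
      (∀ b, χ (Additive.ofMul (derivedComm a b)) = 1) → a ∈ Z)
    (m : ℕ) (σ : Fin m → N ≃* N) (hσ : ∀ i, ∀ z ∈ Z, σ i z = z) (b : Fin m → N) :
    (ofAutFamily hW hZ hnd m σ hσ).toFun b = (List.ofFn fun j => (b j)⁻¹ * σ j (b j)).prod := by
  induction m with
  | zero => simp [ofAutFamily, trivial]
  | succ m ih =>
    rw [List.ofFn_succ, List.prod_cons, ← ih (fun i => σ i.succ) (fun i => hσ i.succ)]
    rfl

/-- The induced homomorphism to the abelianization. -/
def toAb (q : QuadMap Z U) : U →* Abelianization N :=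
  MonoidHom.mk' (fun u => Abelianization.of (q.toFun u)) fun a b => by
    rw [q.map_mul, _root_.map_mul, _root_.map_mul]
    have : Abelianization.of (q.polar a b : N) = 1 :=
      (QuotientGroup.eq_one_iff _).2 (q.polar a b).2
    rw [this, mul_one]

theorem toAb_apply (q : QuadMap Z U) (u : U) : q.toAb u = Abelianization.of (q.toFun u) := rfl

theorem mem_ker_toAb (q : QuadMap Z U) {u : U} : u ∈ q.toAb.ker ↔ q.toFun u ∈ commutator N :=
  QuotientGroup.eq_one_iff _

/-- The radical of the polarisation of `χ ∘ q` on the preimage of the derived subgroup. -/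
def charRad (q : QuadMap Z U) (χ : AddChar (Additive (commutator N)) ℂ) : Subgroup U where
  carrier := {a | a ∈ q.toAb.ker ∧ ∀ b ∈ q.toAb.ker, χ (Additive.ofMul (q.polar a b)) = 1}
  one_mem' := ⟨Subgroup.one_mem _, fun b _ => by
    rw [q.polar_one_left, ofMul_one, AddChar.map_zero_eq_one]⟩
  mul_mem' {a a'} ha ha' := ⟨Subgroup.mul_mem _ ha.1 ha'.1, fun b hb => by
    rw [q.polar_mul_left, ofMul_mul, AddChar.map_add_eq_mul, ha.2 b hb, ha'.2 b hb, one_mul]⟩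
  inv_mem' {a} ha := ⟨Subgroup.inv_mem _ ha.1, fun b hb => by
    have h := q.polar_mul_left a⁻¹ a b
    rw [inv_mul_cancel, q.polar_one_left] at h
    have h' := congrArg (fun x => χ (Additive.ofMul x)) h
    simp only [ofMul_mul, AddChar.map_add_eq_mul] at h'
    rw [ofMul_one, AddChar.map_zero_eq_one, ha.2 b hb, mul_one] at h'
    exact h'.symm⟩

/-- The character `u ↦ χ (polar a u)` is trivial on `q.toAb.ker` by choice of `a` and on `q.rad`
always, so it factors through the quotient of `U` by their product. -/
theorem exists_char_quotient [Finite N] (q : QuadMap Z U) (hs : Function.Surjective q.toAb)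
    (χ : AddChar (Additive (commutator N)) ℂ) {a : U} (ha : a ∈ q.charRad χ) :
    ∃ ψ : AddChar (Additive (Abelianization N ⧸ q.rad.map q.toAb)) ℂ, ∀ u : U,
      ψ (Additive.ofMul (QuotientGroup.mk (q.toAb u))) = χ (Additive.ofMul (q.polar a u)) := by
  let π : U →* Abelianization N ⧸ q.rad.map q.toAb := (QuotientGroup.mk' _).comp q.toAb
  have hπ : Function.Surjective π := (QuotientGroup.mk'_surjective _).comp hs
  let f : U →* ℂ :=
    { toFun u := χ (Additive.ofMul (q.polar a u))
      map_one' := by rw [q.polar_one_right, ofMul_one, AddChar.map_zero_eq_one]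
      map_mul' x y := by rw [q.polar_mul_right, ofMul_mul, AddChar.map_add_eq_mul] }
  have hker : π.ker ≤ f.ker := by
    intro u hu
    have hu' : q.toAb u ∈ q.rad.map q.toAb := (QuotientGroup.eq_one_iff _).1 hu
    obtain ⟨r, hr, hru⟩ := hu'
    have hk : r⁻¹ * u ∈ q.toAb.ker := by
      rw [MonoidHom.mem_ker, _root_.map_mul, map_inv, hru, inv_mul_cancel]
    have hfr : f r = 1 := by
      change χ (Additive.ofMul (q.polar a r)) = 1
      rw [q.polar_rad a r hr, ofMul_one, AddChar.map_zero_eq_one]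
    have hfk : f (r⁻¹ * u) = 1 := ha.2 _ hk
    rw [MonoidHom.mem_ker, ← mul_inv_cancel_left r u, _root_.map_mul, hfr, hfk, one_mul]
  exact exists_addChar_of_ker_le π hπ f hker

/-- Let `A` be the index of the image of `rad` and `K = q.toAb.ker`. Modulo `rad`, `charRad χ`
embeds in a character group of order `A`, so restricting to `K` enlarges the radical by a factor of
at most `A`. Since `K · rad` has index `A`, the cubic hypothesis gives `[K : K ∩ rad] ≥ A²`, which
leaves a factor `A` to spare. -/
theorem card_charRad_mul_le [Finite N] [Finite U] (q : QuadMap Z U)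
    (hs : Function.Surjective q.toAb)
    (h3 : (q.rad.map q.toAb).index ^ 3 ≤ q.rad.index)
    {χ : AddChar (Additive (commutator N)) ℂ} (hχ : χ ≠ 0) :
    Nat.card (q.charRad χ) * (q.rad.map q.toAb).index ≤ Nat.card q.toAb.ker := by
  have := q.rad_normal
  set A := (q.rad.map q.toAb).index with hA
  have hA0 : 0 < A := Nat.pos_of_ne_zero Subgroup.index_ne_zero_of_finite
  choose! ψ hψ using fun a (ha : a ∈ q.charRad χ) => q.exists_char_quotient hs χ ha
  have hinj : Function.Injective
      (fun x : q.charRad χ ⧸ q.rad.subgroupOf (q.charRad χ) => ψ (x.out : q.charRad χ)) := by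
    intro x y hxy
    rw [← x.out_eq', ← y.out_eq', QuotientGroup.eq, Subgroup.mem_subgroupOf]
    refine q.nondeg χ hχ _ fun b => ?_
    have h1 := hψ _ (x.out : q.charRad χ).2 b
    have h2 := hψ _ (y.out : q.charRad χ).2 b
    have hxy : ψ (x.out : q.charRad χ) = ψ (y.out : q.charRad χ) := hxy
    rw [← hxy, h1] at h2
    have h := q.polar_mul_left ((x.out : q.charRad χ) : U)
      (((x.out : q.charRad χ) : U)⁻¹ * (y.out : q.charRad χ)) b
    rw [mul_inv_cancel_left] at h
    rw [h, ofMul_mul, AddChar.map_add_eq_mul] at h2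
    have hne : χ (Additive.ofMul (q.polar ((x.out : q.charRad χ) : U) b)) ≠ 0 := by
      intro h0
      have := AddChar.norm_apply χ (Additive.ofMul (q.polar ((x.out : q.charRad χ) : U) b))
      simp [h0] at this
    exact (left_eq_mul₀ hne).1 h2
  have hle : q.rad.relIndex (q.charRad χ) ≤ A := by
    have h := Nat.card_le_card_of_injective _ hinj
    have hcard : Nat.card (AddChar (Additive (Abelianization N ⧸ q.rad.map q.toAb)) ℂ) = A := by
      have := Fintype.ofFinite (Additive (Abelianization N ⧸ q.rad.map q.toAb))
      rw [Nat.card_eq_fintype_card, AddChar.card_eq, ← Nat.card_eq_fintype_card]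
      rfl
    rwa [hcard] at h
  have hsup : (q.toAb.ker ⊔ q.rad).index = A := by
    rw [sup_comm, ← Subgroup.comap_map_eq, Subgroup.index_comap_of_surjective _ hs]
  have h1 : q.rad.relIndex q.toAb.ker * A = q.rad.index := by
    rw [← hsup, ← Subgroup.relIndex_sup_right, Subgroup.relIndex_mul_index le_sup_right]
  have h2 : Nat.card (q.charRad χ) =
      Nat.card (q.rad ⊓ q.charRad χ : Subgroup U) * q.rad.relIndex (q.charRad χ) := by
    rw [← Subgroup.inf_relIndex_right, ← Subgroup.relIndex_bot_left, ← Subgroup.relIndex_bot_left,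
      Subgroup.relIndex_mul_relIndex _ _ _ bot_le inf_le_right]
  have h4 : Nat.card q.toAb.ker =
      Nat.card (q.rad ⊓ q.toAb.ker : Subgroup U) * q.rad.relIndex q.toAb.ker := by
    rw [← Subgroup.inf_relIndex_right, ← Subgroup.relIndex_bot_left, ← Subgroup.relIndex_bot_left,
      Subgroup.relIndex_mul_relIndex _ _ _ bot_le inf_le_right]
  have h5 : Nat.card (q.rad ⊓ q.charRad χ : Subgroup U) ≤
      Nat.card (q.rad ⊓ q.toAb.ker : Subgroup U) :=
    Subgroup.card_le_of_le (inf_le_inf_left _ fun a ha => ha.1)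
  have h6 : A * A ≤ q.rad.relIndex q.toAb.ker := by
    rw [← h1] at h3
    refine Nat.le_of_mul_le_mul_right ?_ hA0
    calc A * A * A = A ^ 3 := by ring
      _ ≤ _ := h3
  rw [h2, h4, mul_assoc]
  exact Nat.mul_le_mul h5 ((Nat.mul_le_mul_right _ hle).trans h6)

theorem index_le_index_map_rad [Finite N] (hW : commutator N ≤ Z) (q : QuadMap Z U) :
    Z.index ≤ (q.rad.map q.toAb).index := by
  have h : (q.rad.map q.toAb).comap Abelianization.of ≤ Z := by
    intro n hn
    obtain ⟨r, hr, hrn⟩ := hn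
    have : (q.toFun r)⁻¹ * n ∈ commutator N := QuotientGroup.eq.1 hrn
    rw [← mul_inv_cancel_left (q.toFun r) n]
    exact Z.mul_mem (q.rad_mem r hr) (hW this)
  rw [← Subgroup.index_comap_of_surjective (q.rad.map q.toAb) (QuotientGroup.mk'_surjective _)]
  exact Nat.le_of_dvd (Nat.pos_of_ne_zero Subgroup.index_ne_zero_of_finite)
    (Subgroup.index_dvd_of_le h)

/-- If `j` embeds `U'` compatibly with the maps to the abelianization and with the radicals, and
`U'` already covers the abelianization, then the index of the image of the radical is bounded by
the index of the radical in `U'`. -/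
theorem index_map_rad_le [Finite U'] (q : QuadMap Z U) (q' : QuadMap Z U') (j : U' → U)
    (hj : ∀ u, q.toAb (j u) = q'.toAb u) (hr : ∀ u ∈ q'.rad, j u ∈ q.rad)
    (hs : Function.Surjective q'.toAb) : (q.rad.map q.toAb).index ≤ q'.rad.index := by
  rw [← Subgroup.index_comap_of_surjective (q.rad.map q.toAb) hs]
  refine Nat.le_of_dvd (Nat.pos_of_ne_zero Subgroup.index_ne_zero_of_finite)
    (Subgroup.index_dvd_of_le fun u hu => ?_)
  exact ⟨j u, hr u hu, hj u⟩

/-- The fibre over an element of `N'` lies inside `q.toAb.ker`, where `q` takes values in `N'` and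
the character estimate applies. The factor `|N/N'|` converts the order of this kernel into that of
`U`. -/
theorem card_fiber_ge [Finite N] [Finite U] (hW : commutator N ≤ Z) (q : QuadMap Z U)
    (hs : Function.Surjective q.toAb)
    (h3 : (q.rad.map q.toAb).index ^ 3 ≤ q.rad.index) {c : N} (hc : c ∈ commutator N) :
    (Nat.card U : ℝ) * (√Z.index - (Nat.card (commutator N) - 1)) ≤
      (Nat.card {u : U // q.toFun u = c} : ℝ) * Nat.card (commutator N) * √Z.index *
        Nat.card (Abelianization N) := by
  let Q : q.toAb.ker → Additive (commutator N) :=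
    fun a => Additive.ofMul ⟨q.toFun a, q.mem_ker_toAb.1 a.2⟩
  let B : q.toAb.ker → Additive q.toAb.ker →+ Additive (commutator N) := fun a =>
    AddMonoidHom.mk' (fun b => Additive.ofMul (q.polar a b.toMul)) fun x y =>
      congrArg Additive.ofMul (q.polar_mul_right a x.toMul y.toMul)
  have hQ : ∀ a b, Q (a * b) = Q a + Q b + B a (Additive.ofMul b) := fun a b =>
    congrArg Additive.ofMul (Subtype.ext (q.map_mul a b))
  have hZ0 : 0 < Z.index := Nat.pos_of_ne_zero Subgroup.index_ne_zero_of_finite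
  have hrad : ∀ χ : AddChar (Additive (commutator N)) ℂ, χ ≠ 0 →
      Nat.card {a : q.toAb.ker // ∀ b, χ (B a (Additive.ofMul b)) = 1} * Z.index ≤
        Nat.card q.toAb.ker := by
    intro χ hχ
    refine le_trans ?_ (q.card_charRad_mul_le hs h3 hχ)
    refine Nat.mul_le_mul ?_ (q.index_le_index_map_rad hW)
    refine Nat.card_le_card_of_injective
      (fun a => (⟨a.1.1, a.1.2, fun b hb => a.2 ⟨b, hb⟩⟩ : q.charRad χ)) fun a a' h => ?_
    have h' : (a.1 : U) = a'.1 := congrArg (fun x : q.charRad χ => (x : U)) h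
    exact Subtype.ext (Subtype.ext h')
  have main := card_fiber_ge_of_radical_le Q B hQ Z.index hZ0 hrad (Additive.ofMul ⟨c, hc⟩)
  have hfib : Nat.card {a : q.toAb.ker // Q a = Additive.ofMul ⟨c, hc⟩} =
      Nat.card {u : U // q.toFun u = c} := by
    refine Nat.card_congr
      { toFun a := ⟨a.1, congrArg (fun x => ((Additive.toMul x : commutator N) : N)) a.2⟩
        invFun u := ⟨⟨u.1, q.mem_ker_toAb.2 (by rw [u.2]; exact hc)⟩,
          congrArg Additive.ofMul (Subtype.ext u.2)⟩
        left_inv a := rfl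
        right_inv u := rfl }
  have hW' : Nat.card (Additive (commutator N)) = Nat.card (commutator N) := rfl
  rw [hfib, hW'] at main
  have hcard : Nat.card q.toAb.ker * Nat.card (Abelianization N) = Nat.card U := by
    rw [← q.toAb.ker.card_mul_index, Subgroup.index_ker, MonoidHom.range_eq_top.2 hs,
      Subgroup.card_top]
  rw [← hcard, Nat.cast_mul]
  calc _ = (Nat.card q.toAb.ker * (√Z.index - (Nat.card (commutator N) - 1))) *
        (Nat.card (Abelianization N) : ℝ) := by ring
    _ ≤ _ := by gcongr

end QuadMap

end QuadraticMaps

/-! ### The commutator pairing on `N/Z`. -/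

section IrreducibleAction

open scoped IsMulCommutative

variable {N : Type*} [Group N]

theorem derivedComm_map {Z : Subgroup N} (hW : commutator N ≤ Z) {σ : N ≃* N}
    (hσ : ∀ z ∈ Z, σ z = z) (a b : N) : derivedComm (σ a) (σ b) = derivedComm a b := by
  ext
  rw [← hσ _ (hW (derivedComm a b).2)]
  simp only [coe_derivedComm, map_mul, map_inv]

theorem derivedComm_congr {Z : Subgroup N} (hW : commutator N ≤ Z) (hZ : Z ≤ Subgroup.center N)
    {a a' b b' : N} (ha : a⁻¹ * a' ∈ Z) (hb : b⁻¹ * b' ∈ Z) :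
    derivedComm a b = derivedComm a' b' := by
  have hc := hW.trans hZ
  rw [← mul_inv_cancel_left a a', ← mul_inv_cancel_left b b', derivedComm_mul_left hc,
    derivedComm_eq_one_of_central (hZ ha), mul_one, derivedComm_mul_right hc,
    derivedComm_eq_one_of_central_right (hZ hb), mul_one]

/-- If `Z` is maximal among the subgroups invariant under a set of automorphisms fixing `Z`
pointwise, then every nontrivial character of the derived subgroup gives a pairing with radical
contained in `Z`. -/
theorem mem_of_forall_char_derivedComm {Z : Subgroup N} (hW : commutator N ≤ Z)
    (hZ : Z ≤ Subgroup.center N) (Γ : Set (N ≃* N)) (hΓZ : ∀ σ ∈ Γ, ∀ z ∈ Z, σ z = z)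
    (hΓ : ∀ H : Subgroup N, Z ≤ H → (∀ σ ∈ Γ, ∀ h ∈ H, σ h ∈ H) → H = Z ∨ H = ⊤)
    (χ : AddChar (Additive (commutator N)) ℂ) (hχ : χ ≠ 0) (a : N)
    (ha : ∀ b, χ (Additive.ofMul (derivedComm a b)) = 1) : a ∈ Z := by
  have hc := hW.trans hZ
  let P : Subgroup N :=
    { carrier := {a | ∀ b, χ (Additive.ofMul (derivedComm a b)) = 1}
      one_mem' := fun b => by
        rw [derivedComm_eq_one_of_central (Subgroup.one_mem _), ofMul_one, AddChar.map_zero_eq_one]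
      mul_mem' := fun {x y} hx hy b => by
        rw [derivedComm_mul_left hc, ofMul_mul, AddChar.map_add_eq_mul, hx, hy, one_mul]
      inv_mem' := fun {x} hx b => by
        have h := derivedComm_mul_left hc x⁻¹ x b
        rw [inv_mul_cancel, derivedComm_eq_one_of_central (Subgroup.one_mem _)] at h
        have h' := congrArg (fun x => χ (Additive.ofMul x)) h
        simp only [ofMul_mul, AddChar.map_add_eq_mul] at h'
        rw [ofMul_one, AddChar.map_zero_eq_one, hx, mul_one] at h'
        exact h'.symm }
  have hP : P = Z ∨ P = ⊤ := by
    refine hΓ P (fun z hz b => ?_) (fun σ hσ h hh b => ?_)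
    · rw [derivedComm_eq_one_of_central (hZ hz), ofMul_one, AddChar.map_zero_eq_one]
    · have := derivedComm_map hW (hΓZ _ hσ) h (σ.symm b)
      rw [σ.apply_symm_apply] at this
      rw [this]
      exact hh _
  obtain hP | hP := hP
  · rw [← hP]
    exact ha
  · exfalso
    apply hχ
    -- If the radical were all of `N`, `χ` would be trivial on every commutator, hence on `N'`.
    let f : commutator N →* ℂ := AddChar.toMonoidHomEquiv χ
    have hf : commutator N ≤ f.ker.map (commutator N).subtype := by
      refine Subgroup.commutator_le.2 fun x _ y _ => ?_
      refine ⟨derivedComm x⁻¹ y⁻¹, ?_, ?_⟩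
      · have : x⁻¹ ∈ P := by rw [hP]; trivial
        exact this y⁻¹
      · rw [Subgroup.subtype_apply, coe_derivedComm, commutatorElement_def, inv_inv, inv_inv]
    rw [AddChar.eq_zero_iff]
    intro w
    obtain ⟨w', hw', hww⟩ := hf (Additive.toMul w).2
    have : w' = Additive.toMul w := Subtype.ext hww
    rw [this] at hw'
    exact hw'

theorem card_commutator_sq_le [Finite N] [IsMulCommutative (commutator N)] {Z : Subgroup N} [Z.Normal] (hW : commutator N ≤ Z)
    (hZ : Z ≤ Subgroup.center N) (hZt : Z ≠ ⊤)
    (Γ : Set (N ≃* N)) (hΓZ : ∀ σ ∈ Γ, ∀ z ∈ Z, σ z = z)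
    (hΓ : ∀ H : Subgroup N, Z ≤ H → (∀ σ ∈ Γ, ∀ h ∈ H, σ h ∈ H) → H = Z ∨ H = ⊤) :
    Nat.card (commutator N) ^ 2 ≤ Z.index := by
  have hc := hW.trans hZ
  let _ : CommGroup (N ⧸ Z) :=
    { (inferInstance : Group (N ⧸ Z)) with
      mul_comm := by
        rintro ⟨a⟩ ⟨b⟩
        refine QuotientGroup.eq.2 (hW ?_)
        have := (derivedComm b a).2
        rw [coe_derivedComm] at this
        convert this using 1
        group }
  have hout : ∀ a : N, (Quotient.out (a : N ⧸ Z))⁻¹ * a ∈ Z := fun a =>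
    QuotientGroup.eq.1 (QuotientGroup.out_eq' _)
  have hmk : ∀ a b : N, derivedComm (a : N ⧸ Z).out (b : N ⧸ Z).out = derivedComm a b :=
    fun a b => derivedComm_congr hW hZ (hout a) (hout b)
  let ω : Additive (N ⧸ Z) →+ Additive (N ⧸ Z) →+ Additive (commutator N) :=
    AddMonoidHom.mk' (fun x => AddMonoidHom.mk'
      (fun y => Additive.ofMul (derivedComm x.toMul.out y.toMul.out)) (by
        rintro ⟨b⟩ ⟨c⟩
        obtain ⟨a, ha⟩ := QuotientGroup.mk_surjective x.toMul
        rw [← ha]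
        change Additive.ofMul (derivedComm (a : N ⧸ Z).out ((b * c : N) : N ⧸ Z).out) =
          Additive.ofMul (derivedComm (a : N ⧸ Z).out (b : N ⧸ Z).out *
            derivedComm (a : N ⧸ Z).out (c : N ⧸ Z).out)
        rw [hmk, hmk, hmk, derivedComm_mul_right hc])) (by
      rintro ⟨a⟩ ⟨b⟩
      refine AddMonoidHom.ext ?_
      rintro ⟨c⟩
      change derivedComm ((a * b : N) : N ⧸ Z).out (c : N ⧸ Z).out =
          (derivedComm (a : N ⧸ Z).out (c : N ⧸ Z).out *
            derivedComm (b : N ⧸ Z).out (c : N ⧸ Z).out)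
      rw [hmk, hmk, hmk, derivedComm_mul_left hc])
  have hω : ∀ a b : N, ω (Additive.ofMul (a : N ⧸ Z)) (Additive.ofMul (b : N ⧸ Z)) =
      Additive.ofMul (derivedComm a b) := fun a b => congrArg Additive.ofMul (hmk a b)
  have hcomap : ∀ σ ∈ Γ, Z ≤ Z.comap (σ : N →* N) := fun σ hσ z hz => by
    rw [Subgroup.mem_comap]
    change σ z ∈ Z
    rwa [hΓZ σ hσ z hz]
  let S : Set (AddMonoid.End (Additive (N ⧸ Z))) :=
    {s | ∃ σ ∈ Γ, ∀ a : N, s (Additive.ofMul (a : N ⧸ Z)) = Additive.ofMul ((σ a : N) : N ⧸ Z)}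
  have hSmem : ∀ σ ∈ Γ, ∃ s ∈ S, ∀ a : N,
      s (Additive.ofMul (a : N ⧸ Z)) = Additive.ofMul ((σ a : N) : N ⧸ Z) := fun σ hσ =>
    ⟨MonoidHom.toAdditive (QuotientGroup.map Z Z (σ : N →* N) (hcomap σ hσ)),
      ⟨σ, hσ, fun _ => rfl⟩, fun _ => rfl⟩
  have : Nontrivial (Additive (N ⧸ Z)) := by
    have : Nontrivial (N ⧸ Z) := by
      obtain ⟨a, ha⟩ : ∃ a, a ∉ Z := by
        by_contra! h
        exact hZt (eq_top_iff.2 fun x _ => h x)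
      exact ⟨(a : N ⧸ Z), 1, fun h => ha ((QuotientGroup.eq_one_iff a).1 h)⟩
    infer_instance
  refine card_sq_le_of_invariant_pairing (V := Additive (N ⧸ Z)) (W := Additive (commutator N)) S ?_ ω ?_ ?_ ?_
  · intro L hL
    let H : Subgroup N := (AddSubgroup.toSubgroup' L).comap (QuotientGroup.mk' Z)
    have hH : ∀ a : N, a ∈ H ↔ Additive.ofMul (a : N ⧸ Z) ∈ L := fun _ => Iff.rfl
    have := hΓ H (fun z hz => by
        rw [hH, (QuotientGroup.eq_one_iff z).2 hz]
        exact L.zero_mem) (fun σ hσ h hh => by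
        obtain ⟨s, hs, hs'⟩ := hSmem σ hσ
        rw [hH] at hh ⊢
        rw [← hs']
        exact hL s hs _ hh)
    obtain h | h := this
    · left
      rw [AddSubgroup.eq_bot_iff_forall]
      rintro ⟨a⟩ ha
      have : a ∈ Z := by rw [← h]; exact ha
      exact (QuotientGroup.eq_one_iff a).2 this
    · right
      refine eq_top_iff.2 ?_
      rintro ⟨a⟩ -
      have : a ∈ H := by rw [h]; trivial
      exact this
  · rintro ⟨a⟩
    exact (hω a a).trans (congrArg Additive.ofMul (derivedComm_self a))
  · rintro s ⟨σ, hσ, hs⟩ ⟨a⟩ ⟨b⟩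
    change ω (s (Additive.ofMul (a : N ⧸ Z))) (s (Additive.ofMul (b : N ⧸ Z))) =
      ω (Additive.ofMul (a : N ⧸ Z)) (Additive.ofMul (b : N ⧸ Z))
    rw [hs, hs, hω, hω, derivedComm_map hW (hΓZ σ hσ)]
  · rintro χ hχ ⟨a⟩ ha
    refine (QuotientGroup.eq_one_iff a).2
      (mem_of_forall_char_derivedComm hW hZ Γ hΓZ hΓ χ hχ a fun b => ?_)
    rw [← hω]
    exact ha _

end IrreducibleAction

/-! ### Pigeonhole on fibres. -/

section Counting

theorem card_le_mul_of_fiber_le {A X : Type*} [Finite A] [Finite X] (f : A → X) (t : ℝ)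
    (h : ∀ x, (Nat.card {a // f a = x} : ℝ) ≤ t) : (Nat.card A : ℝ) ≤ t * Nat.card X := by
  classical
  have := Fintype.ofFinite X
  rw [← Nat.card_congr (Equiv.sigmaFiberEquiv f), Nat.card_sigma, Nat.cast_sum]
  calc _ ≤ ∑ _x : X, t := Finset.sum_le_sum fun x _ => h x
    _ = _ := by rw [Finset.sum_const, nsmul_eq_mul, Finset.card_univ, Nat.card_eq_fintype_card,
        mul_comm]

/-- If `φ₀(u₀) φ₁(u₁) φ₂(u₂) = c` has many solutions, then it has one for which all three fibres
are large. -/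
theorem exists_large_fibers {U N : Type*} [Finite U] [Group N] (φ : Fin 3 → U → N) (c : N) (t : ℝ)
    (h : 3 * t * (Nat.card U : ℝ) ^ 2 <
      Nat.card {u : U × U × U // φ 0 u.1 * (φ 1 u.2.1 * φ 2 u.2.2) = c}) :
    ∃ c' : Fin 3 → N, c = c' 0 * c' 1 * c' 2 ∧
      ∀ i, t ≤ (Nat.card {u : U // φ i u = c' i} : ℝ) := by
  classical
  by_contra! hcon
  let T := {u : U × U × U // φ 0 u.1 * (φ 1 u.2.1 * φ 2 u.2.2) = c}
  let F : Fin 3 → U → ℝ := fun i u => (Nat.card {u' : U // φ i u' = φ i u} : ℝ)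
  have hU : (Nat.card (U × U) : ℝ) = (Nat.card U : ℝ) ^ 2 := by
    rw [Nat.card_prod, Nat.cast_mul, sq]
  -- Once the other two coordinates `g x` are fixed, the equation forces the value of `φ i`. A
  -- coordinate lying in a small fibre then has fewer than `t` choices.
  have bound : ∀ (i : Fin 3) (p : T → U) (g : T → U × U) (k : U × U → N),
      (∀ x y : T, g x = g y → p x = p y → x = y) → (∀ x : T, φ i (p x) = k (g x)) → 0 ≤ t →
      (Nat.card {x : T // F i (p x) < t} : ℝ) ≤ t * (Nat.card U : ℝ) ^ 2 := by
    intro i p g k hinj hk ht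
    rw [← hU]
    refine card_le_mul_of_fiber_le (fun x : {x : T // F i (p x) < t} => g x.1) t fun z => ?_
    by_cases hz : Nonempty {x : {x : T // F i (p x) < t} // g x.1 = z}
    · obtain ⟨⟨x, hx⟩, hxz⟩ := hz
      refine le_trans ?_ hx.le
      refine Nat.cast_le.2 (Nat.card_le_card_of_injective
        (fun y => (⟨p y.1.1, by rw [hk, hk, y.2, hxz]⟩ : {u' : U // φ i u' = φ i (p x)})) ?_)
      intro y y' hyy
      exact Subtype.ext (Subtype.ext (hinj _ _ (y.2.trans y'.2.symm) (congrArg Subtype.val hyy)))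
    · rw [not_nonempty_iff] at hz
      rw [Nat.card_of_isEmpty, Nat.cast_zero]
      exact ht
  have ht : 0 ≤ t := by
    by_contra! ht
    obtain ⟨i, hi⟩ := hcon ![c, 1, 1] (by simp)
    exact absurd (hi.trans ht) (not_lt.2 (Nat.cast_nonneg _))
  have h0 := bound 0 (fun x => x.1.1) (fun x => x.1.2) (fun z => c * (φ 1 z.1 * φ 2 z.2)⁻¹)
    (fun x y h1 h2 => Subtype.ext (Prod.ext h2 h1)) (fun x => eq_mul_inv_of_mul_eq x.2) ht
  have h1 := bound 1 (fun x => x.1.2.1) (fun x => (x.1.1, x.1.2.2))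
    (fun z => (φ 0 z.1)⁻¹ * c * (φ 2 z.2)⁻¹)
    (fun x y h1 h2 => Subtype.ext (Prod.ext (Prod.ext_iff.1 h1).1
      (Prod.ext h2 (Prod.ext_iff.1 h1).2)))
    (fun x => by
      have hx : _ = c := x.2
      simp only [← hx]
      group) ht
  have h2 := bound 2 (fun x => x.1.2.2) (fun x => (x.1.1, x.1.2.1))
    (fun z => (φ 1 z.2)⁻¹ * (φ 0 z.1)⁻¹ * c)
    (fun x y h1 h2 => Subtype.ext (Prod.ext (Prod.ext_iff.1 h1).1
      (Prod.ext (Prod.ext_iff.1 h1).2 h2)))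
    (fun x => by
      have hx : _ = c := x.2
      simp only [← hx]
      group) ht
  have hcover : Nat.card T ≤ Nat.card {x : T // F 0 x.1.1 < t} +
      (Nat.card {x : T // F 1 x.1.2.1 < t} + Nat.card {x : T // F 2 x.1.2.2 < t}) := by
    rw [← Nat.card_sum, ← Nat.card_sum]
    refine Nat.card_le_card_of_surjective
      (Sum.elim (fun x => x.1) (Sum.elim (fun x => x.1) fun x => x.1)) fun x => ?_
    obtain ⟨i, hi⟩ := hcon ![φ 0 x.1.1, φ 1 x.1.2.1, φ 2 x.1.2.2] (by simp [← x.2, mul_assoc])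
    fin_cases i
    · exact ⟨Sum.inl ⟨x, hi⟩, rfl⟩
    · exact ⟨Sum.inr (Sum.inl ⟨x, hi⟩), rfl⟩
    · exact ⟨Sum.inr (Sum.inr ⟨x, hi⟩), rfl⟩
  have hcover' : (Nat.card T : ℝ) ≤ Nat.card {x : T // F 0 x.1.1 < t} +
      (Nat.card {x : T // F 1 x.1.2.1 < t} + Nat.card {x : T // F 2 x.1.2.2 < t}) := by
    exact_mod_cast hcover
  linarith

end Counting

/-! ### Covering the abelianization by commutators. -/

section Surjectivity

variable {N : Type*} [Group N]

/-- The homomorphism `Nᵐ → N / N'` sending `b` to the class of `∏ bⱼ⁻¹ σⱼ(bⱼ)`. -/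
def commProdAb {m : ℕ} (σ : Fin m → N ≃* N) : (Fin m → N) →* Abelianization N :=
  MonoidHom.mk' (fun b => ∏ j, Abelianization.of ((b j)⁻¹ * σ j (b j))) fun a b => by
    rw [← Finset.prod_mul_distrib]
    refine Finset.prod_congr rfl fun j _ => ?_
    simp only [Pi.mul_apply, map_mul, map_inv, mul_inv]
    simp only [mul_assoc, mul_comm, mul_left_comm]

theorem commProdAb_apply {m : ℕ} (σ : Fin m → N ≃* N) (b : Fin m → N) :
    commProdAb σ b = ∏ j, Abelianization.of ((b j)⁻¹ * σ j (b j)) := rfl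

theorem of_mem_range_commProdAb {m : ℕ} (σ : Fin m → N ≃* N) (j : Fin m) (b : N) :
    Abelianization.of (b⁻¹ * σ j b) ∈ (commProdAb σ).range := by
  refine ⟨Pi.mulSingle j b, ?_⟩
  rw [commProdAb_apply, Finset.prod_eq_single j]
  · rw [Pi.mulSingle_eq_same]
  · intro i _ hij
    rw [Pi.mulSingle_eq_of_ne hij]
    simp
  · simp

variable {G : Type*} [Group G]

/-- The elements of `G` acting trivially on `N` modulo the preimage `H` of the range form a
subgroup. It contains `C` and all `y j`, so it is `G`, and `N = [N, G] ≤ H`. -/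
theorem commProdAb_surjective (N C : Subgroup G) [N.Normal]
    (hN : N = ⁅N, (⊤ : Subgroup G)⁆) (hCN : ⁅C, N⁆ = ⊥) {m : ℕ} (y : Fin m → G)
    (hy : C ⊔ Subgroup.closure (Set.range y) = ⊤) :
    Function.Surjective (commProdAb fun j => (MulAut.conjNormal (y j)⁻¹ : N ≃* N)) := by
  set Ψ := commProdAb fun j => (MulAut.conjNormal (y j)⁻¹ : N ≃* N) with hΨ
  let H : Subgroup N := Ψ.range.comap Abelianization.of
  let T : Subgroup G :=
    { carrier := {g | ∀ b : N, b⁻¹ * MulAut.conjNormal g b ∈ H}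
      one_mem' := fun b => by simp
      mul_mem' := fun {g h} hg hh b => by
        have := H.mul_mem (hh b) (hg (MulAut.conjNormal h b))
        rw [map_mul, MulAut.mul_apply]
        convert this using 1
        group
      inv_mem' := fun {g} hg b => by
        have := H.inv_mem (hg (MulAut.conjNormal g⁻¹ b))
        rw [← MulAut.mul_apply, ← map_mul, mul_inv_cancel, map_one, MulAut.one_apply,
          mul_inv_rev, inv_inv] at this
        exact this }
  have hT : T = ⊤ := by
    rw [eq_top_iff, ← hy, sup_le_iff, Subgroup.closure_le]
    constructor
    · intro c hc b
      have h1 : (MulAut.conjNormal c b : N) = b := by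
        ext
        rw [MulAut.conjNormal_apply]
        have := Subgroup.commutator_mem_commutator hc b.2
        rw [hCN, Subgroup.mem_bot, commutatorElement_def] at this
        exact mul_inv_eq_one.1 this
      rw [h1, inv_mul_cancel]
      exact H.one_mem
    · rintro _ ⟨j, rfl⟩
      rw [SetLike.mem_coe, ← T.inv_mem_iff]
      exact fun b => of_mem_range_commProdAb _ j b
  have hH : N ≤ H.map N.subtype := by
    conv_lhs => rw [hN]
    refine Subgroup.commutator_le.2 fun b hb g _ => ?_
    have hg : g ∈ T := by rw [hT]; trivial
    refine ⟨_, hg (⟨b, hb⟩⁻¹), ?_⟩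
    rw [inv_inv, Subgroup.subtype_apply, Subgroup.coe_mul, MulAut.conjNormal_apply,
      commutatorElement_def]
    simp [mul_assoc]
  intro x
  obtain ⟨n, rfl⟩ := QuotientGroup.mk_surjective x
  obtain ⟨n', hn', hnn⟩ := hH n.2
  have : n' = n := Subtype.ext hnn
  rw [this] at hn'
  exact hn'

theorem exists_lift_generators [Finite G] (C : Subgroup G) [C.Normal] :
    ∃ y : Fin (Group.rank (G ⧸ C)) → G, C ⊔ Subgroup.closure (Set.range y) = ⊤ := by
  obtain ⟨S, hS, hS'⟩ := Group.rank_spec (G ⧸ C)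
  let e : Fin (Group.rank (G ⧸ C)) ≃ S := (finCongr hS.symm).trans S.equivFin.symm
  refine ⟨fun i => (e i : G ⧸ C).out, ?_⟩
  set Y := Set.range fun i => (e i : G ⧸ C).out
  have himg : QuotientGroup.mk' C '' Y = (S : Set (G ⧸ C)) := by
    rw [← Set.range_comp]
    ext x
    constructor
    · rintro ⟨i, rfl⟩
      simp
    · intro hx
      refine ⟨e.symm ⟨x, hx⟩, ?_⟩
      simp
  have h : (Subgroup.closure Y).map (QuotientGroup.mk' C) = ⊤ := by
    rw [MonoidHom.map_closure, himg, hS']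
  have h2 := congrArg (Subgroup.comap (QuotientGroup.mk' C)) h
  rw [Subgroup.comap_map_eq, QuotientGroup.ker_mk', Subgroup.comap_top, sup_comm] at h2
  exact h2

/-- Apply the surjectivity result to `d(G/C)` lifted generators. As `G` fixes `Z` pointwise, each
factor `b⁻¹ σ(b)` depends only on `b` modulo `Z`, so `(N/Z)^r` already covers `N/N'`. -/
theorem card_abelianization_le [Finite G] (N C : Subgroup G) [N.Normal] [C.Normal]
    (hN : N = ⁅N, (⊤ : Subgroup G)⁆) (hCN : ⁅C, N⁆ = ⊥) (Z : Subgroup N)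
    (hZ : ∀ g : G, ∀ z ∈ Z, MulAut.conjNormal g z = z) :
    Nat.card (Abelianization N) ≤ Z.index ^ Group.rank (G ⧸ C) := by
  obtain ⟨y, hy⟩ := exists_lift_generators C
  have hs := commProdAb_surjective N C hN hCN y hy
  have hs' : Function.Surjective (fun b : Fin (Group.rank (G ⧸ C)) → N ⧸ Z =>
      commProdAb (fun j => (MulAut.conjNormal (y j)⁻¹ : N ≃* N)) fun j => (b j).out) := by
    intro x
    obtain ⟨b, rfl⟩ := hs x
    refine ⟨fun j => (b j : N ⧸ Z), ?_⟩
    refine (commProdAb_apply _ _).trans ((commProdAb_apply _ _).trans ?_).symm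
    symm
    refine Finset.prod_congr rfl fun j _ => ?_
    have h1 : ((b j : N ⧸ Z).out)⁻¹ * b j ∈ Z := QuotientGroup.eq.1 (QuotientGroup.out_eq' _)
    have h2 := hZ (y j)⁻¹ _ h1
    rw [map_mul, map_inv, inv_mul_eq_iff_eq_mul] at h2
    rw [h2]
    simp only [map_mul, map_inv]
    rw [mul_comm, mul_comm (Abelianization.of (b j))⁻¹, mul_assoc, mul_assoc, mul_inv_cancel,
      mul_one]
  refine (Nat.card_le_card_of_surjective _ hs').trans ?_
  rw [Nat.card_fun, Nat.card_fin]
  rfl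

end Surjectivity

/-! ### Consequences of the maximality of `Z`. -/

section QuasiMinimal

variable {G : Type*} [Group G] {N Z : Subgroup G}

/-- If `N'Z = N`, the nontrivial soluble group `N/Z` would be perfect. So `N'Z` is a normal subgroup
properly below `N`, and maximality absorbs it into `Z`. -/
theorem IsMaximalNormalBelow.commutator_le (hZ : IsMaximalNormalBelow N Z) [N.Normal]
    (hsol : Group.IsSolvable N) : ⁅N, N⁆ ≤ Z := by
  have hZn : Z.Normal := hZ.prop.1
  have hZN : Z ≤ N := hZ.prop.2.le
  set Zn := Z.subgroupOf N with hZn'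
  have hlt : commutator (N ⧸ Zn) < ⊤ := by
    have : Nontrivial (N ⧸ Zn) := by
      rw [QuotientGroup.nontrivial_iff]
      intro h
      exact hZ.prop.2.not_ge (Subgroup.subgroupOf_eq_top.1 h)
    exact Group.IsSolvable.commutator_lt_top_of_nontrivial _
  have hmap : (commutator N).map (QuotientGroup.mk' Zn) = commutator (N ⧸ Zn) := by
    rw [commutator_def, commutator_def, Subgroup.map_commutator,
      Subgroup.map_top_of_surjective _ (QuotientGroup.mk'_surjective _)]
  have hsub : ⁅N, N⁆ = (commutator N).map N.subtype := (Subgroup.map_subtype_commutator N).symm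
  have hle : ⁅N, N⁆ ⊔ Z ≤ N := sup_le (Subgroup.commutator_le_left N N) hZN
  refine le_sup_left.trans (hZ.le_of_ge ⟨inferInstance, hle.lt_of_ne fun heq => ?_⟩ le_sup_right)
  refine hlt.ne ?_
  rw [← hmap, eq_top_iff]
  rintro x -
  obtain ⟨n, rfl⟩ := QuotientGroup.mk_surjective x
  have hn : (n : G) ∈ ⁅N, N⁆ ⊔ Z := by rw [heq]; exact n.2
  rw [Subgroup.mem_sup_of_normal_right] at hn
  obtain ⟨a, ha, z, hz, haz⟩ := hn
  rw [hsub] at ha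
  obtain ⟨a', ha', rfl⟩ := ha
  refine ⟨a', ha', QuotientGroup.eq.2 ?_⟩
  rw [Subgroup.mem_subgroupOf, Subgroup.coe_mul, ← haz, Subgroup.coe_inv]
  simpa using hz

theorem conj_eq_of_commutator_eq_bot (hZG : ⁅Z, (⊤ : Subgroup G)⁆ = ⊥) {z : G} (hz : z ∈ Z)
    (g : G) : g * z * g⁻¹ = z := by
  have := Subgroup.commutator_mem_commutator hz (Subgroup.mem_top g)
  rw [hZG, Subgroup.mem_bot, commutatorElement_def, mul_inv_eq_one,
    mul_inv_eq_iff_eq_mul] at this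
  rw [mul_inv_eq_iff_eq_mul, this]

theorem IsMaximalNormalBelow.eq_or_eq_top (hZ : IsMaximalNormalBelow N Z) [N.Normal]
    (H : Subgroup N) (hH : Z.subgroupOf N ≤ H)
    (hinv : ∀ g : G, ∀ h ∈ H, MulAut.conjNormal g h ∈ H) : H = Z.subgroupOf N ∨ H = ⊤ := by
  have hZN : Z ≤ N := hZ.prop.2.le
  have hnorm : (H.map N.subtype).Normal := by
    refine ⟨?_⟩
    rintro _ ⟨h, hh, rfl⟩ g
    exact ⟨_, hinv g h hh, MulAut.conjNormal_apply g h⟩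
  have hle : H.map N.subtype ≤ N := Subgroup.map_subtype_le H
  have hZH : Z ≤ H.map N.subtype := fun z hz => ⟨⟨z, hZN hz⟩, hH hz, rfl⟩
  obtain heq | hne := eq_or_ne (H.map N.subtype) N
  · right
    rw [eq_top_iff]
    rintro n -
    have hn : (n : G) ∈ H.map N.subtype := by rw [heq]; exact n.2
    obtain ⟨h, hh, hhn⟩ := hn
    rwa [← show h = n from Subtype.ext hhn]
  · left
    refine le_antisymm (fun h hh => ?_) hH
    exact hZ.le_of_ge ⟨hnorm, hle.lt_of_ne hne⟩ hZH ⟨h, hh, rfl⟩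

end QuasiMinimal

/-! ### Numerical estimate and assembly. -/

/-- Numerical comparison of the expected number of solutions with the loss in the pigeonhole
argument. -/
theorem pigeonhole_bound {u v w x T : ℝ} {r : ℕ} (hu : 0 < u) (hv : 2 ≤ v) (hw : w = 1 ∨ 2 ≤ w)
    (hwv : w ^ 2 ≤ v) (hx : 0 < x) (hxv : x ≤ v ^ r)
    (hT : u ^ 3 * (√v - (w - 1)) ≤ T * w * √v * x) :
    3 * (u * v ^ (-(r : ℤ) - 2)) * u ^ 2 < T := by
  have hv0 : 0 < v := by linarith
  set s := √v with hs
  have hs0 : 0 < s := Real.sqrt_pos.2 hv0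
  have hsv : s ^ 2 = v := Real.sq_sqrt hv0.le
  have hw0 : 0 < w := by obtain h | h := hw <;> linarith
  have hws : w ≤ s := Real.le_sqrt_of_sq_le hwv
  -- For `w = 1` this is `3 < v²`. For `w ≥ 2`, `w ≤ s` makes the first factor at least `1`, and `s²
  -- = v ≥ 4` gives `s³ ≥ 4w`.
  have key : 3 * w < (s - (w - 1)) * s ^ 3 := by
    obtain rfl | h := hw
    · have : s ^ 4 = v ^ 2 := by rw [← hsv]; ring
      nlinarith
    · have h1 : w * 4 ≤ s ^ 3 := by
        calc w * 4 ≤ s * s ^ 2 := by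
              refine mul_le_mul hws ?_ (by norm_num) hs0.le
              nlinarith
          _ = s ^ 3 := by ring
      have h2 : s ^ 3 ≤ (s - (w - 1)) * s ^ 3 := by
        have : 0 < s ^ 3 := by positivity
        nlinarith
      linarith
  have hpow : v ^ (-(r : ℤ) - 2) * (v ^ r * s ^ 4) = 1 := by
    have : s ^ 4 = v ^ 2 := by rw [← hsv]; ring
    rw [this, ← pow_add, ← zpow_natCast, ← zpow_add₀ hv0.ne']
    simp
  set p := v ^ (-(r : ℤ) - 2) with hp
  have hp0 : 0 < p := by positivity
  have hwsx : 0 < w * s * x := by positivity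
  refine lt_of_mul_lt_mul_right ?_ hwsx.le
  calc 3 * (u * p) * u ^ 2 * (w * s * x) = u ^ 3 * (p * x * s) * (3 * w) := by ring
    _ < u ^ 3 * (p * x * s) * ((s - (w - 1)) * s ^ 3) := by gcongr
    _ = u ^ 3 * (s - (w - 1)) * (p * (x * s ^ 4)) := by ring
    _ ≤ u ^ 3 * (s - (w - 1)) * (p * (v ^ r * s ^ 4)) := by
        have : 0 ≤ s - (w - 1) := by linarith
        gcongr
    _ = u ^ 3 * (s - (w - 1)) := by rw [hpow, mul_one]
    _ ≤ T * w * s * x := hT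
    _ = T * (w * s * x) := by ring

open scoped IsMulCommutative in
theorem mainTheorem11 {G : Type*} [Group G] [Finite G]
    (N C Z : Subgroup G) [N.Normal] [C.Normal]
    (hsol : Group.IsSolvable N) (hN : IsQuasiMinimalNormal N)
    (hZ : IsMaximalNormalBelow N Z)
    (hZG : ⁅Z, (⊤ : Subgroup G)⁆ = ⊥)
    (hCN : ⁅C, N⁆ = ⊥)
    (m : ℕ) (y : Fin 3 → Fin m → G)
    (hy : ∀ i, C ⊔ Subgroup.closure (Set.range (y i)) = ⊤)
    (c : G) (hc : c ∈ ⁅N, N⁆) :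
    ∃ c' : Fin 3 → N, c = (c' 0 : G) * (c' 1 : G) * (c' 2 : G) ∧
      ∀ i : Fin 3,
        (Nat.card N : ℝ) ^ m *
            (Nat.card (N ⧸ Z.subgroupOf N) : ℝ) ^ (-(Group.rank (G ⧸ C) : ℤ) - 2) ≤
          (Nat.card {b : Fin m → N // commProdMap N (y i) b = c' i} : ℝ) := by
  have hZn : Z.Normal := hZ.prop.1
  set Zn := Z.subgroupOf N with hZn_def
  have hsub : (commutator N).map N.subtype = ⁅N, N⁆ := Subgroup.map_subtype_commutator N
  have hW : commutator N ≤ Zn := fun w hw =>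
    hZ.commutator_le hsol (by rw [← hsub]; exact ⟨w, hw, rfl⟩)
  have hfix : ∀ g : G, ∀ z ∈ Zn, MulAut.conjNormal g z = z := fun g z hz =>
    Subtype.ext (by rw [MulAut.conjNormal_apply]; exact conj_eq_of_commutator_eq_bot hZG hz g)
  have hcen : Zn ≤ Subgroup.center N := fun z hz => Subgroup.mem_center_iff.2 fun n =>
    Subtype.ext (by
      have := conj_eq_of_commutator_eq_bot hZG hz (n : G)
      rw [mul_inv_eq_iff_eq_mul] at this
      exact this)
  have : IsMulCommutative (commutator N) := ⟨⟨fun a b =>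
    Subtype.ext (Subgroup.mem_center_iff.1 (hcen (hW b.2)) a)⟩⟩
  let Γ : Set (N ≃* N) := Set.range fun g : G => (MulAut.conjNormal g : N ≃* N)
  have hΓZ : ∀ σ ∈ Γ, ∀ z ∈ Zn, σ z = z := by
    rintro _ ⟨g, rfl⟩ z hz
    exact hfix g z hz
  have hΓ : ∀ H : Subgroup N, Zn ≤ H → (∀ σ ∈ Γ, ∀ h ∈ H, σ h ∈ H) → H = Zn ∨ H = ⊤ :=
    fun H hH hinv => hZ.eq_or_eq_top H hH fun g => hinv _ ⟨g, rfl⟩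
  have hnd := mem_of_forall_char_derivedComm hW hcen Γ hΓZ hΓ
  have hZt : Zn ≠ ⊤ := fun h => hZ.prop.2.not_ge (Subgroup.subgroupOf_eq_top.1 h)
  have hcard := card_commutator_sq_le hW hcen hZt Γ hΓZ hΓ
  -- The inverse matches the convention: `[b, y] = b⁻¹ (y⁻¹ b y)`.
  let σ : Fin 3 → Fin m → (N ≃* N) := fun i j => MulAut.conjNormal (y i j)⁻¹
  let q : Fin 3 → QuadMap Zn (Fin m → N) := fun i =>
    QuadMap.ofAutFamily hW hcen hnd m (σ i) fun j => hfix _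
  have hq : ∀ i b, (q i).toFun b = commProdMap N (y i) b := by
    intro i b
    rw [QuadMap.ofAutFamily_toFun, commProdMap]
    congr 2
    ext j
    simp [σ, rightComm, mul_assoc]
  have hs : ∀ i, Function.Surjective (q i).toAb := by
    intro i
    have h : (q i).toAb = commProdAb (σ i) := by
      ext b
      rw [QuadMap.toAb_apply, QuadMap.ofAutFamily_toFun, map_list_prod, List.map_ofFn,
        List.prod_ofFn]
      rfl
    rw [h]
    exact commProdAb_surjective N C hN.prop.2.2 hCN (y i) (hy i)
  let Q := (q 0).prod (hW.trans hcen) hcen ((q 1).prod (hW.trans hcen) hcen (q 2))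
  have hQ : ∀ u, Q.toAb u = (q 0).toAb u.1 * ((q 1).toAb u.2.1 * (q 2).toAb u.2.2) := fun u => by
    simp only [QuadMap.toAb_apply, ← map_mul]
    rfl
  have hQs : Function.Surjective Q.toAb := fun x => by
    obtain ⟨u, rfl⟩ := hs 0 x
    exact ⟨(u, 1, 1), by rw [hQ]; simp⟩
  have hrad : Q.rad.index = (q 0).rad.index * ((q 1).rad.index * (q 2).rad.index) := by
    rw [← Subgroup.index_prod, ← Subgroup.index_prod]
    rfl
  -- Each of the three factors alone covers `N/N'`, so the index of the image of the radical is at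
  -- most each factor's radical index; the product of those three is the index of `Q.rad`.
  have h3 : (Q.rad.map Q.toAb).index ^ 3 ≤ Q.rad.index := by
    have h0 := Q.index_map_rad_le (q 0) (fun u => (u, 1, 1)) (fun u => by rw [hQ]; simp)
      (fun u hu => ⟨hu, Subgroup.one_mem _, Subgroup.one_mem _⟩) (hs 0)
    have h1 := Q.index_map_rad_le (q 1) (fun u => (1, u, 1)) (fun u => by rw [hQ]; simp)
      (fun u hu => ⟨Subgroup.one_mem _, hu, Subgroup.one_mem _⟩) (hs 1)
    have h2 := Q.index_map_rad_le (q 2) (fun u => (1, 1, u)) (fun u => by rw [hQ]; simp)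
      (fun u hu => ⟨Subgroup.one_mem _, Subgroup.one_mem _, hu⟩) (hs 2)
    rw [hrad, pow_succ', sq]
    exact Nat.mul_le_mul h0 (Nat.mul_le_mul h1 h2)
  obtain ⟨c₀, hc₀, rfl⟩ : ∃ c₀ ∈ commutator N, (c₀ : G) = c := by
    rw [← hsub] at hc
    exact hc
  have main := Q.card_fiber_ge hW hQs h3 hc₀
  have hX := card_abelianization_le N C hN.prop.2.2 hCN Zn hfix
  have hidx : 2 ≤ Zn.index := by
    have h0 : Zn.index ≠ 0 := Subgroup.index_ne_zero_of_finite
    have h1 : Zn.index ≠ 1 := fun h => hZt (Subgroup.index_eq_one.1 h)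
    omega
  have hw : Nat.card (commutator N) = 1 ∨ 2 ≤ Nat.card (commutator N) := by
    have : 0 < Nat.card (commutator N) := Nat.card_pos
    omega
  have hbound := pigeonhole_bound (u := (Nat.card (Fin m → N) : ℝ)) (v := Zn.index)
    (w := Nat.card (commutator N)) (x := Nat.card (Abelianization N))
    (T := Nat.card {u // Q.toFun u = c₀}) (r := Group.rank (G ⧸ C))
    (by exact_mod_cast Nat.card_pos) (by exact_mod_cast hidx)
    (by exact_mod_cast hw) (by exact_mod_cast hcard) (by exact_mod_cast Nat.card_pos)
    (by exact_mod_cast hX) (by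
      have hU : (Nat.card ((Fin m → N) × (Fin m → N) × (Fin m → N)) : ℝ) =
          (Nat.card (Fin m → N) : ℝ) ^ 3 := by
        rw [Nat.card_prod, Nat.card_prod]
        push_cast
        ring
      rw [← hU]
      exact main)
  obtain ⟨c', hc', hfib⟩ := exists_large_fibers (fun i => (q i).toFun) c₀ _ hbound
  refine ⟨c', congrArg Subtype.val hc', fun i => ?_⟩
  have := hfib i
  simp only [hq] at this
  rw [Nat.card_fun, Nat.card_fin, Nat.cast_pow] at this
  exact this
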